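/- Fix an integer $d\ge 2$ and $r\in\mathbb{C}$. Let $\hat{\mathfrak h}$ be the complex Lie algebra with basis $\{v^i(m)\mid 1\le i\le d,\ m\in\mathbb{Z}\}\cup\{\mathbf c\}$, where $\mathbf c$ is central and $[v^i(m),v^j(n)]=\delta_{m+n,0}\,\delta_{i,j}\,m\,\mathbf c$. In $U(\hat{\mathfrak h})/\langle \mathbf c-1\rangle$ put $v^{ij}(m,n)=v^i(m)v^j(n)$, let $$\mathcal B=\{v^{ii}(m,n)\mid 1\le i\le d,\ m\le n\}\cup\{v^{ij}(m,n)\mid 1\le i<j\le d,\ m,n\in\mathbb{Z}\},$$ and let $\mathcal L=\operatorname{Span}\mathcal B\oplus\mathbb{C}$, with projections $\pi_1:\mathcal L\to\operatorname{Span}\mathcal B$ and $\pi_2:\mathcal L\to\mathbb{C}$. Let $\mathcal L_r$ be the Lie algebra with underlying space $\mathcal L$ and bracket $[x,y]_r=\pi_1(xy-yx)+r\,\pi_2(xy-yx)$. Let $\mathcal B_+$ be the set of all $v^{ij}(m,n)\in\mathcal B$ with $m\ge 0$ or $n\ge 0$, let $\mathcal L_r^+=\operatorname{Span}\mathcal B_+\oplus\mathbb{C}$,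 a Lie subalgebra of $\mathcal L_r$, and let $\mathbb{C}\mathbf 1$ be the one-dimensional $\mathcal L_r^+$-module on which $\mathcal B_+$ acts by $0$ and each $s\in\mathbb{C}\subset\mathcal L_r^+$ acts by $s$. Let $$M_r=U(\mathcal L_r)\otimes_{U(\mathcal L_r^+)}\mathbb{C}\mathbf 1$$ be the induced module. For $1\le i,j\le d$ and $m\in\mathbb{Z}$ let $L_r^{ij}(m)\in\operatorname{End}(M_r)$ be the operator $$L_r^{ij}(m)=\begin{cases}\frac12\sum_{h\in\mathbb{Z}}v^{ij}(m-h,h) & \text{if } i\ne j \text{ or } m\ne 0,\\ \frac12 v^{ii}(0,0)+\sum_{h>0}v^{ii}(-h,h) & \text{if } i=j \text{ and } m=0\end{cases}$$ (on each vector of $M_r$ only finitely many terms are nonzero). Let $V_{\mathcal J}\subset M_r$ be the subspace spanned by all elements $$L_r^{i_1j_1}(m_1)\cdots L_r^{i_pj_p}(m_p)\mathbf 1,\qquad p\ge 0,\ 1\le i_q,j_q\le d,\ m_q\in\mathbb{Z}.$$ **Proposition.** $V_{\mathcal J}=M_r$. Moreover, the elements $L_r^{i_1j_1}(m_1)\cdots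 L_r^{i_pj_p}(m_p)\mathbf 1$ with $p\ge 0$, $1\le i_q,j_q\le d$ and all $m_q\in\{-2,-1,0\}$ already span $M_r$. -/

import Mathlib

noncomputable section

open scoped TensorProduct

namespace VJordan

attribute [local instance] LieRing.ofAssociativeRing

/-- The Heisenberg Lie algebra `ĥ`: the complex vector space with basis
`{v^i(m) | i, m ∈ ℤ} ∪ {c}`. A pair `(x, s)` stands for `∑ x(i,m) v^i(m) + s c`. -/
def Heis (d : ℕ) : Type := ((Fin d × ℤ) →₀ ℂ) × ℂ

namespace Heis
variable {d : ℕ}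
instance : AddCommGroup (Heis d) := inferInstanceAs (AddCommGroup (((Fin d × ℤ) →₀ ℂ) × ℂ))
instance : Module ℂ (Heis d) := inferInstanceAs (Module ℂ (((Fin d × ℤ) →₀ ℂ) × ℂ))

/-- The element `∑ x(i,m) v^i(m) + s c`. -/
def mk (x : (Fin d × ℤ) →₀ ℂ) (s : ℂ) : Heis d := (x, s)

/-- The basis element `v^i(m)`. -/
def vec (i : Fin d) (m : ℤ) : Heis d := mk (Finsupp.single (i, m) 1) 0
/-- The basis element `c`. -/
def cen : Heis d := mk 0 1

/-- The bilinear form with `(v^i(m), v^j(n)) ↦ δ_{m+n,0} δ_{i,j} m`, see `form_single`. -/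
def form : ((Fin d × ℤ) →₀ ℂ) →ₗ[ℂ] ((Fin d × ℤ) →₀ ℂ) →ₗ[ℂ] ℂ :=
  Finsupp.linearCombination ℂ fun k => (k.2 : ℂ) • Finsupp.lapply (k.1, -k.2)

theorem form_single (i j : Fin d) (m n : ℤ) :
    form (Finsupp.single (i, m) 1) (Finsupp.single (j, n) 1)
      = if m + n = 0 ∧ i = j then (m : ℂ) else 0 := by
  have h : ((j, n) = (i, -m)) ↔ (m + n = 0 ∧ i = j) := by
    rw [Prod.mk.injEq]; constructor
    · rintro ⟨rfl, rfl⟩; simp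
    · rintro ⟨h, rfl⟩; exact ⟨rfl, by omega⟩
  simp [form, Finsupp.single_apply, h]

theorem form_neg (x y : (Fin d × ℤ) →₀ ℂ) : form x y = - form y x := by
  have : (form : ((Fin d × ℤ) →₀ ℂ) →ₗ[ℂ] ((Fin d × ℤ) →₀ ℂ) →ₗ[ℂ] ℂ)
      = - LinearMap.flip form := by
    ext ⟨i, m⟩ ⟨j, n⟩
    simp only [LinearMap.comp_apply, Finsupp.lsingle_apply, LinearMap.neg_apply,
      LinearMap.flip_apply, form_single]
    by_cases h : m + n = 0 ∧ i = j
    · obtain ⟨h, rfl⟩ := h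
      obtain rfl : m = -n := by omega
      simp
    · rw [if_neg h, if_neg (fun h' => h ⟨by omega, h'.2.symm⟩)]; simp
  conv_lhs => rw [this]
  rfl

theorem form_self (x : (Fin d × ℤ) →₀ ℂ) : form x x = 0 :=
  self_eq_neg.mp (form_neg x x)

/-- `[x, y] = form(x, y) c`; in particular `c` is central. See `lie_vec` for basis elements. -/
instance : Bracket (Heis d) (Heis d) := ⟨fun x y => mk 0 (form x.1 y.1)⟩

theorem lie_def (x y : Heis d) : ⁅x, y⁆ = mk 0 (form x.1 y.1) := rfl

instance : LieRing (Heis d) where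
  add_lie x y z := by
    refine Prod.ext (add_zero (0 : (Fin d × ℤ) →₀ ℂ)).symm ?_
    change form (x.1 + y.1) z.1 = form x.1 z.1 + form y.1 z.1
    simp
  lie_add x y z := by
    refine Prod.ext (add_zero (0 : (Fin d × ℤ) →₀ ℂ)).symm ?_
    change form x.1 (y.1 + z.1) = form x.1 y.1 + form x.1 z.1
    simp
  lie_self x := Prod.ext rfl (form_self x.1)
  leibniz_lie x y z := by
    refine Prod.ext (add_zero (0 : (Fin d × ℤ) →₀ ℂ)).symm ?_
    change form x.1 0 = form 0 z.1 + form y.1 0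
    simp

instance : LieAlgebra ℂ (Heis d) where
  lie_smul t x y := by
    refine Prod.ext (smul_zero t).symm ?_
    change form x.1 (t • y.1) = t • form x.1 y.1
    simp

theorem lie_vec (i j : Fin d) (m n : ℤ) :
    ⁅vec i m, vec j n⁆ = (if m + n = 0 ∧ i = j then (m : ℂ) else 0) • (cen : Heis d) := by
  refine Prod.ext (smul_zero _).symm ?_
  change form (Finsupp.single (i, m) 1) (Finsupp.single (j, n) 1) = _ • (1:ℂ)
  rw [form_single]; simp

end Heis

/-- The relation `c ∼ 1` on `U(ĥ)`. -/
inductive WeylRel (d : ℕ) : UniversalEnvelopingAlgebra ℂ (Heis d) →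
    UniversalEnvelopingAlgebra ℂ (Heis d) → Prop
  | central : WeylRel d (UniversalEnvelopingAlgebra.ι ℂ Heis.cen) 1

/-- The algebra `U(ĥ)/⟨c - 1⟩`. -/
abbrev Weyl (d : ℕ) : Type := RingQuot (WeylRel d)

variable {d : ℕ}

/-- The canonical map `ĥ → U(ĥ)/⟨c - 1⟩`. -/
def toWeyl (d : ℕ) : Heis d →ₗ⁅ℂ⁆ Weyl d :=
  (RingQuot.mkAlgHom ℂ (WeylRel d)).toLieHom.comp (UniversalEnvelopingAlgebra.ι ℂ)

/-- The image of `v^i(m)` in `U(ĥ)/⟨c - 1⟩`. -/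
def osc (i : Fin d) (m : ℤ) : Weyl d := toWeyl d (Heis.vec i m)

/-- `v^{ij}(m, n) = v^i(m) v^j(n)` in `U(ĥ)/⟨c - 1⟩`. -/
def quad (i j : Fin d) (m n : ℤ) : Weyl d := osc i m * osc j n

theorem toWeyl_cen : toWeyl d Heis.cen = 1 := by
  change RingQuot.mkAlgHom ℂ (WeylRel d) (UniversalEnvelopingAlgebra.ι ℂ Heis.cen) = 1
  rw [RingQuot.mkAlgHom_rel ℂ WeylRel.central, map_one]

/-- The scalar `δ_{m+n,0} δ_{i,j} m`. -/
def heisCoeff (i j : Fin d) (m n : ℤ) : ℂ := if m + n = 0 ∧ i = j then (m : ℂ) else 0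

theorem lie_osc (i j : Fin d) (m n : ℤ) :
    ⁅osc i m, osc j n⁆ = heisCoeff i j m n • (1 : Weyl d) := by
  rw [osc, osc, ← LieHom.map_lie, Heis.lie_vec, map_smul, toWeyl_cen, heisCoeff]

theorem osc_comm (i j : Fin d) (m n : ℤ) :
    osc i m * osc j n = osc j n * osc i m + heisCoeff i j m n • (1 : Weyl d) := by
  rw [← lie_osc, Ring.lie_def]; abel

/-! The Fock representation of `U(ĥ)/⟨c - 1⟩` on polynomials. It serves only to prove that the sum
`Span B + ℂ` is direct, so that the projections onto its summands exist. -/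

/-- The polynomial space that carries the Fock representation. -/
abbrev Poly (d : ℕ) := MvPolynomial (Fin d × ℤ) ℂ

/-- `v^i(m)` acts by multiplication by `X_{i,m}` if `m < 0` and by `m ∂/∂X_{i,-m}` if `m ≥ 0`. -/
def fockOp (k : Fin d × ℤ) : Module.End ℂ (Poly d) :=
  if k.2 < 0 then LinearMap.mulLeft ℂ (MvPolynomial.X k)
  else (k.2 : ℂ) • (MvPolynomial.pderiv (R := ℂ) (k.1, -k.2)).toLinearMap



theorem fockOp_neg {i : Fin d} {m : ℤ} (hm : m < 0) (f : Poly d) :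
    fockOp (i, m) f = MvPolynomial.X (i, m) * f := by
  simp [fockOp, hm]

theorem fockOp_nonneg {i : Fin d} {m : ℤ} (hm : ¬ m < 0) (f : Poly d) :
    fockOp (i, m) f = (m : ℂ) • MvPolynomial.pderiv (i, -m) f := by
  simp only [fockOp, if_neg hm]
  rfl

theorem pderiv_comm (k l : Fin d × ℤ) (f : Poly d) :
    MvPolynomial.pderiv k (MvPolynomial.pderiv l f)
      = MvPolynomial.pderiv l (MvPolynomial.pderiv k f) := by
  have h : ⁅(MvPolynomial.pderiv k : Derivation ℂ (Poly d) (Poly d)),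
      (MvPolynomial.pderiv l : Derivation ℂ (Poly d) (Poly d))⁆ = 0 := by
    refine MvPolynomial.derivation_ext fun p => ?_
    classical
    rw [Derivation.commutator_apply, MvPolynomial.pderiv_X, MvPolynomial.pderiv_X]
    simp only [Pi.single_apply, Derivation.zero_apply]
    split_ifs <;> simp
  have h2 := congrArg (fun D : Derivation ℂ (Poly d) (Poly d) => D f) h
  simpa [Derivation.commutator_apply, sub_eq_zero] using h2

theorem fockOp_lie (i j : Fin d) (m n : ℤ) :
    ⁅fockOp (i, m), fockOp (j, n)⁆ = heisCoeff i j m n • (1 : Module.End ℂ (Poly d)) := by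
  refine LinearMap.ext fun f => ?_
  rw [Ring.lie_def, heisCoeff, LinearMap.sub_apply, Module.End.mul_apply, Module.End.mul_apply,
    LinearMap.smul_apply, Module.End.one_apply]
  by_cases hm : m < 0 <;> by_cases hn : n < 0
  · have h0 : ¬ (m + n = 0 ∧ i = j) := by omega
    simp only [fockOp_neg hm, fockOp_neg hn, if_neg h0, zero_smul]
    ring
  · simp only [fockOp_neg hm, fockOp_nonneg hn, MvPolynomial.pderiv_mul]
    by_cases h : m + n = 0 ∧ i = j
    · obtain ⟨h, rfl⟩ := h
      obtain rfl : n = -m := by omega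
      simp
    · have h1 : ¬ ((i, m) = (j, -n)) := by
        rw [Prod.mk.injEq]; omega
      simp [h, MvPolynomial.pderiv_X_of_ne h1]
  · simp only [fockOp_neg hn, fockOp_nonneg hm, MvPolynomial.pderiv_mul]
    by_cases h : m + n = 0 ∧ i = j
    · obtain ⟨h, rfl⟩ := h
      obtain rfl : n = -m := by omega
      simp
    · have h1 : ¬ ((j, n) = (i, -m)) := by
        rw [Prod.mk.injEq]; omega
      simp [h, MvPolynomial.pderiv_X_of_ne h1]
  · have h1 : (if m + n = 0 ∧ i = j then (m : ℂ) else 0) = 0 := by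
      split_ifs with h
      · have : m = 0 := by omega
        simp [this]
      · rfl
    simp only [fockOp_nonneg hn, fockOp_nonneg hm, h1, zero_smul]
    rw [Derivation.map_smul, Derivation.map_smul, pderiv_comm, smul_comm, sub_self]

theorem fock_lie (x y : (Fin d × ℤ) →₀ ℂ) :
    ⁅Finsupp.linearCombination ℂ fockOp x, Finsupp.linearCombination ℂ fockOp y⁆
      = Heis.form x y • (1 : Module.End ℂ (Poly d)) := by
  induction x using Finsupp.induction_linear with
  | zero => simp
  | add x x' hx hx' => rw [map_add, map_add, add_lie, hx, hx', LinearMap.add_apply, add_smul]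
  | single k a =>
    induction y using Finsupp.induction_linear with
    | zero => simp
    | add x x' hx hx' => rw [map_add, map_add, lie_add, hx, hx', add_smul]
    | single l b =>
      rw [← mul_one a, ← smul_eq_mul, ← Finsupp.smul_single, ← mul_one b, ← smul_eq_mul b,
        ← Finsupp.smul_single]
      simp only [map_smul, LinearMap.smul_apply, Finsupp.linearCombination_single, one_smul]
      obtain ⟨i, m⟩ := k
      obtain ⟨j, n⟩ := l
      have h := fockOp_lie i j m n
      rw [Ring.lie_def] at h
      rw [Ring.lie_def, smul_mul_smul_comm, smul_mul_smul_comm, mul_comm b a]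
      refine (smul_sub (a * b) _ _).symm.trans ?_
      rw [h, Heis.form_single, heisCoeff]
      refine (smul_smul _ _ _).trans ?_
      congr 1
      simp only [smul_eq_mul]
      ring

theorem fock_lie' (x y : (Fin d × ℤ) →₀ ℂ) (s t : ℂ) :
    ⁅Finsupp.linearCombination ℂ fockOp x + s • (1 : Module.End ℂ (Poly d)),
      Finsupp.linearCombination ℂ fockOp y + t • 1⁆
      = Heis.form x y • (1 : Module.End ℂ (Poly d)) := by
  rw [← fock_lie, Ring.lie_def, Ring.lie_def]
  simp only [add_mul, mul_add, smul_mul_assoc, mul_smul_comm, one_mul, mul_one]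
  simp only [smul_add]
  rw [smul_comm s t]
  abel

/-- The Fock representation of the Heisenberg Lie algebra, with `c` acting as the identity. -/
def fockHom (d : ℕ) : Heis d →ₗ⁅ℂ⁆ Module.End ℂ (Poly d) :=
  { toFun := fun x => Finsupp.linearCombination ℂ fockOp x.1 + x.2 • 1
    map_add' := fun x y => by
      change Finsupp.linearCombination ℂ fockOp (x.1 + y.1) + (x.2 + y.2) • 1 = _
      rw [map_add, add_smul]; abel
    map_smul' := fun t x => by
      change Finsupp.linearCombination ℂ fockOp (t • x.1) + (t • x.2) • 1 = _
      simp [mul_smul]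
    map_lie' := by
      intro x y
      change Finsupp.linearCombination ℂ fockOp 0 + (Heis.form x.1 y.1) • 1 =
        ⁅Finsupp.linearCombination ℂ fockOp x.1 + x.2 • 1,
          Finsupp.linearCombination ℂ fockOp y.1 + y.2 • 1⁆
      refine Eq.trans ?_ (fock_lie' x.1 y.1 x.2 y.2).symm
      rw [map_zero, zero_add] }

/-- The Fock representation of `U(ĥ)/⟨c - 1⟩`. -/
def fock (d : ℕ) : Weyl d →ₐ[ℂ] Module.End ℂ (Poly d) :=
  RingQuot.liftAlgHom ℂ ⟨UniversalEnvelopingAlgebra.lift ℂ (fockHom d), by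
    rintro _ _ ⟨⟩
    rw [UniversalEnvelopingAlgebra.lift_ι_apply, map_one]
    change Finsupp.linearCombination ℂ fockOp 0 + (1 : ℂ) • 1 = _
    simp⟩

theorem fock_osc (i : Fin d) (m : ℤ) : fock d (osc i m) = fockOp (i, m) := by
  change fock d (RingQuot.mkAlgHom ℂ (WeylRel d) (UniversalEnvelopingAlgebra.ι ℂ _)) = _
  rw [fock, RingQuot.liftAlgHom_mkAlgHom_apply, UniversalEnvelopingAlgebra.lift_ι_apply]
  change Finsupp.linearCombination ℂ fockOp (Finsupp.single (i, m) 1) + (0 : ℂ) • 1 = _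
  simp

/-- The constant term of `x · 1` in the Fock representation. -/
def vacExp (d : ℕ) : Weyl d →ₗ[ℂ] ℂ :=
  (MvPolynomial.lcoeff ℂ (0 : (Fin d × ℤ) →₀ ℕ)) ∘ₗ LinearMap.applyₗ (1 : Poly d) ∘ₗ (fock d).toLinearMap

theorem vacExp_apply (x : Weyl d) : vacExp d x = MvPolynomial.coeff 0 (fock d x 1) := rfl

theorem vacExp_one : vacExp d 1 = 1 := by
  simp [vacExp_apply]

/-- The indices of the elements `v^{ij}(m, n)` of the set `B`: either `i < j`, or `i = j` and
`m ≤ n`. -/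
def IsNormal (i j : Fin d) (m n : ℤ) : Prop := i < j ∨ (i = j ∧ m ≤ n)

theorem vacExp_quad {i j : Fin d} {m n : ℤ} (h : IsNormal i j m n) : vacExp d (quad i j m n) = 0 := by
  rw [vacExp_apply, quad, map_mul, fock_osc, fock_osc, Module.End.mul_apply]
  by_cases hn : n < 0
  · rw [fockOp_neg hn]
    by_cases hm : m < 0
    · rw [fockOp_neg hm, ← MvPolynomial.constantCoeff_eq]; simp
    · rw [fockOp_nonneg hm]
      have h1 : ¬ ((j, n) = (i, -m)) := by
        rw [Prod.mk.injEq]; unfold IsNormal at h; omega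
      simp [MvPolynomial.pderiv_X_of_ne h1]
  · rw [fockOp_nonneg hn]; simp

/-- The set `B`. -/
def basisB (d : ℕ) : Set (Weyl d) :=
  {x | ∃ i j m n, IsNormal i j m n ∧ x = quad i j m n}

/-- `Span B`. -/
def spanB (d : ℕ) : Submodule ℂ (Weyl d) := Submodule.span ℂ (basisB d)

/-- The space `ℒ = Span B ⊕ ℂ ⊂ U(ĥ)/⟨c - 1⟩`; the sum is direct by `isCompl_parts`. -/
def calL (d : ℕ) : Submodule ℂ (Weyl d) := spanB d ⊔ Submodule.span ℂ {1}

theorem vacExp_of_mem_spanB {x : Weyl d} (hx : x ∈ spanB d) : vacExp d x = 0 := by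
  induction hx using Submodule.span_induction with
  | mem x h => obtain ⟨i, j, m, n, h, rfl⟩ := h; exact vacExp_quad h
  | zero => simp
  | add x y _ _ h1 h2 => simp [h1, h2]
  | smul a x _ h => simp [h]

theorem one_mem_calL : (1 : Weyl d) ∈ calL d :=
  Submodule.mem_sup_right (Submodule.mem_span_singleton_self 1)

theorem quad_swap (i j : Fin d) (m n : ℤ) :
    quad i j m n = quad j i n m + heisCoeff i j m n • (1 : Weyl d) := osc_comm i j m n

theorem quad_mem_calL (i j : Fin d) (m n : ℤ) : quad i j m n ∈ calL d := by
  by_cases h : IsNormal i j m n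
  · exact Submodule.mem_sup_left (Submodule.subset_span ⟨i, j, m, n, h, rfl⟩)
  · rw [quad_swap]
    have h' : IsNormal j i n m := by unfold IsNormal at *; omega
    exact add_mem (Submodule.mem_sup_left (Submodule.subset_span ⟨j, i, n, m, h', rfl⟩))
      (Submodule.smul_mem _ _ one_mem_calL)

theorem calL_induction {P : Weyl d → Prop} (hq : ∀ i j m n, P (quad i j m n)) (h1 : P 1)
    (hadd : ∀ x y, P x → P y → P (x + y)) (hsmul : ∀ (a : ℂ) x, P x → P (a • x))
    {x : Weyl d} (hx : x ∈ calL d) : P x := by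
  have h0 : P 0 := by simpa using hsmul 0 _ h1
  let S : Submodule ℂ (Weyl d) :=
    { carrier := {x | P x}
      add_mem' := fun {x y} hx hy => hadd x y hx hy
      zero_mem' := h0
      smul_mem' := fun a x hx => hsmul a x hx }
  have hle : calL d ≤ S := by
    refine sup_le (Submodule.span_le.2 ?_) (Submodule.span_le.2 ?_)
    · rintro _ ⟨i, j, m, n, _, rfl⟩; exact hq i j m n
    · rintro _ rfl; exact h1
  exact hle hx

theorem quad_comm (i j k l : Fin d) (m n p q : ℤ) :
    quad i j m n * quad k l p q - quad k l p q * quad i j m n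
      = heisCoeff j k n p • quad i l m q + heisCoeff i k m p • quad j l n q
        + heisCoeff j l n q • quad k i p m + heisCoeff i l m q • quad k j p n := by
  have key : ∀ (i j : Fin d) (m n : ℤ),
      osc i m * osc j n - osc j n * osc i m = heisCoeff i j m n • (1 : Weyl d) := fun i j m n => by
    rw [osc_comm i j m n]; abel
  have e1 := key j k n p
  have e2 := key i k m p
  have e3 := key j l n q
  have e4 := key i l m q
  simp only [quad]
  generalize osc i m = a at *
  generalize osc j n = b at *
  generalize osc k p = c at *
  generalize osc l q = e at *
  have : a * b * (c * e) - c * e * (a * b)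
      = a * (b * c - c * b) * e + (a * c - c * a) * (b * e)
        + c * a * (b * e - e * b) + c * (a * e - e * a) * b := by noncomm_ring
  rw [this, e1, e2, e3, e4]
  simp

theorem comm_mem_calL {x y : Weyl d} (hx : x ∈ calL d) (hy : y ∈ calL d) :
    x * y - y * x ∈ calL d := by
  refine calL_induction (P := fun x => x * y - y * x ∈ calL d) ?_ ?_ ?_ ?_ hx
  · intro i j m n
    refine calL_induction (P := fun y => quad i j m n * y - y * quad i j m n ∈ calL d)
      ?_ ?_ ?_ ?_ hy
    · intro k l p q
      rw [quad_comm]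
      refine add_mem (add_mem (add_mem ?_ ?_) ?_) ?_ <;>
        exact Submodule.smul_mem _ _ (quad_mem_calL _ _ _ _)
    · simp
    · intro x x' h h'
      rw [mul_add, add_mul, add_sub_add_comm]
      exact add_mem h h'
    · intro a x h
      rw [smul_mul_assoc, mul_smul_comm, ← smul_sub]
      exact Submodule.smul_mem _ _ h
  · simp
  · intro x x' h h'
    rw [mul_add, add_mul, add_sub_add_comm]
    exact add_mem h h'
  · intro a x h
    rw [smul_mul_assoc, mul_smul_comm, ← smul_sub]
    exact Submodule.smul_mem _ _ h

/-- The element `1 ∈ ℂ ⊂ ℒ`. -/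
def unitL (d : ℕ) : calL d := ⟨1, one_mem_calL⟩

/-- `Span B` as a subspace of `ℒ`. -/
def partB (d : ℕ) : Submodule ℂ (calL d) := (spanB d).comap (calL d).subtype
/-- `ℂ = ℂ 1` as a subspace of `ℒ`. -/
abbrev partC (d : ℕ) : Submodule ℂ (calL d) := Submodule.span ℂ {unitL d}

theorem isCompl_parts (d : ℕ) : IsCompl (partB d) (partC d) := by
  refine ⟨Submodule.disjoint_def.2 fun x hx hy => ?_, codisjoint_iff.2 (eq_top_iff.2 ?_)⟩
  · obtain ⟨a, rfl⟩ := Submodule.mem_span_singleton.1 hy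
    have h := vacExp_of_mem_spanB (d := d) hx
    have h2 : vacExp d ((calL d).subtype (a • unitL d)) = a := by
      simp [unitL, vacExp_one]
    rw [h2] at h
    rw [h, zero_smul]
  · rintro ⟨x, hx⟩ -
    obtain ⟨y, hy, z, hz, rfl⟩ := Submodule.mem_sup.1 hx
    obtain ⟨a, rfl⟩ := Submodule.mem_span_singleton.1 hz
    refine Submodule.mem_sup.2 ⟨⟨y, Submodule.mem_sup_left hy⟩, hy, a • unitL d,
      Submodule.smul_mem _ _ (Submodule.mem_span_singleton_self _), rfl⟩

theorem unitL_ne_zero (d : ℕ) : unitL d ≠ 0 := by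
  intro h
  have h1 : (1 : Weyl d) = 0 := congrArg Subtype.val h
  have h2 := vacExp_one (d := d)
  rw [h1, map_zero] at h2
  exact zero_ne_one h2

/-- The projection `π₁ : ℒ → Span B` along `ℂ`. -/
def proj₁ (d : ℕ) : calL d →ₗ[ℂ] partB d := (partB d).projectionOnto (partC d) (isCompl_parts d)

/-- The projection `π₂ : ℒ → ℂ` along `Span B`; `coord` identifies `ℂ 1` with `ℂ`. -/
def proj₂ (d : ℕ) : calL d →ₗ[ℂ] ℂ :=
  (LinearEquiv.coord ℂ (calL d) (unitL d) (unitL_ne_zero d)).toLinearMap ∘ₗ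
    (partC d).projectionOnto (partB d) (isCompl_parts d).symm

theorem proj₂_smul (x : calL d) :
    proj₂ d x • unitL d = (partC d).projection (partB d) (isCompl_parts d).symm x :=
  LinearEquiv.coord_apply_smul ℂ (calL d) (unitL d) (unitL_ne_zero d) _

theorem proj_add (x : calL d) : (proj₁ d x : calL d) + proj₂ d x • unitL d = x := by
  rw [proj₂_smul]
  exact Submodule.projection_add_projection_eq_self (isCompl_parts d) x

theorem proj₂_of_mem_partB {x : calL d} (hx : x ∈ partB d) : proj₂ d x = 0 := by
  have h := proj₂_smul x
  rw [Submodule.projection_apply_of_mem_right _ hx] at h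
  exact (smul_eq_zero.1 h).resolve_right (unitL_ne_zero d)

theorem proj₂_unitL : proj₂ d (unitL d) = 1 := by
  have h := proj₂_smul (unitL d)
  rw [Submodule.projection_apply_of_mem_left _ (Submodule.mem_span_singleton_self _)] at h
  have h2 : (proj₂ d (unitL d) - 1) • unitL d = 0 := by rw [sub_smul, h, one_smul, sub_self]
  exact sub_eq_zero.1 ((smul_eq_zero.1 h2).resolve_right (unitL_ne_zero d))

/-- The commutator `[x, y] = xy - yx` on `ℒ`. -/
def commL (x y : calL d) : calL d := ⟨x * y - y * x, comm_mem_calL x.2 y.2⟩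

@[simp] theorem coe_commL (x y : calL d) : (commL x y : Weyl d) = x * y - y * x := rfl

/-- The Lie algebra `ℒ_r`: the space `ℒ` with the bracket `[x, y]_r = π₁([x, y]) + r π₂([x, y])`. -/
def Lr (d : ℕ) (_r : ℂ) : Type := calL d

namespace Lr
variable {r : ℂ}

instance : AddCommGroup (Lr d r) := inferInstanceAs (AddCommGroup (calL d))
instance : Module ℂ (Lr d r) := inferInstanceAs (Module ℂ (calL d))

/-- The identity map from `ℒ_r` to `ℒ`. -/
def toL (d : ℕ) (r : ℂ) : Lr d r ≃ₗ[ℂ] calL d := LinearEquiv.refl ℂ (calL d)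

/-- The map `π₁ + r π₂ : ℒ → ℒ`. -/
def twist (d : ℕ) (r : ℂ) : calL d →ₗ[ℂ] calL d :=
  (partB d).subtype ∘ₗ proj₁ d + r • (proj₂ d).smulRight (unitL d)

theorem twist_apply (x : calL d) :
    twist d r x = (proj₁ d x : calL d) + (r * proj₂ d x) • unitL d := by
  simp [twist, mul_smul]

theorem twist_eq (x : calL d) : twist d r x = x + ((r - 1) * proj₂ d x) • unitL d := by
  rw [twist_apply]
  conv_rhs => rw [← proj_add x]
  rw [map_add, map_smul, proj₂_unitL, proj₂_of_mem_partB (proj₁ d x).2]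
  module

/-- `[x, y]_r = π₁([x, y]) + r π₂([x, y])`. -/
instance : Bracket (Lr d r) (Lr d r) :=
  ⟨fun x y => (toL d r).symm (twist d r (commL (toL d r x) (toL d r y)))⟩

theorem toL_lie (x y : Lr d r) :
    toL d r ⁅x, y⁆ = twist d r (commL (toL d r x) (toL d r y)) := rfl

theorem commL_unit_right (x : calL d) (a : ℂ) : commL x (a • unitL d) = 0 := by
  ext; simp [unitL]

theorem commL_unit_left (x : calL d) (a : ℂ) : commL (a • unitL d) x = 0 := by
  ext; simp [unitL]

theorem commL_add_right (x y z : calL d) : commL x (y + z) = commL x y + commL x z := by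
  ext; simp only [coe_commL, Submodule.coe_add]; noncomm_ring

theorem commL_add_left (x y z : calL d) : commL (x + y) z = commL x z + commL y z := by
  ext; simp only [coe_commL, Submodule.coe_add]; noncomm_ring

theorem commL_smul_right (a : ℂ) (x y : calL d) : commL x (a • y) = a • commL x y := by
  ext; simp only [coe_commL, Submodule.coe_smul, smul_mul_assoc, mul_smul_comm, smul_sub]

theorem commL_smul_left (a : ℂ) (x y : calL d) : commL (a • x) y = a • commL x y := by
  ext; simp only [coe_commL, Submodule.coe_smul, smul_mul_assoc, mul_smul_comm, smul_sub]

theorem commL_twist_right (x y : calL d) : commL x (twist d r y) = commL x y := by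
  rw [twist_eq, commL_add_right, commL_unit_right, add_zero]

theorem commL_twist_left (x y : calL d) : commL (twist d r x) y = commL x y := by
  rw [twist_eq, commL_add_left, commL_unit_left, add_zero]

instance : LieRing (Lr d r) where
  add_lie x y z := (toL d r).injective <| by
    simp only [toL_lie, map_add, commL_add_left]
  lie_add x y z := (toL d r).injective <| by
    simp only [toL_lie, map_add, commL_add_right]
  lie_self x := (toL d r).injective <| by
    have : commL (toL d r x) (toL d r x) = 0 := Subtype.ext (by rw [coe_commL, sub_self]; rfl)
    rw [toL_lie, this, map_zero, map_zero]
  leibniz_lie x y z := (toL d r).injective <| by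
    rw [map_add]
    simp only [toL_lie]
    rw [commL_twist_right, commL_twist_right, commL_twist_left, ← map_add]
    congr 1
    ext
    simp only [coe_commL, Submodule.coe_add]
    noncomm_ring

instance : LieAlgebra ℂ (Lr d r) where
  lie_smul t x y := (toL d r).injective <| by
    simp only [toL_lie, map_smul, commL_smul_right]

variable (r) in
/-- `v^{ij}(m, n)` as an element of `ℒ_r`. -/
def v (i j : Fin d) (m n : ℤ) : Lr d r :=
  (toL d r).symm ⟨quad i j m n, quad_mem_calL i j m n⟩

end Lr


namespace Lr
variable {r : ℂ}

/-- `1 ∈ ℂ ⊂ ℒ_r`. -/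
def one (d : ℕ) (r : ℂ) : Lr d r := (toL d r).symm (unitL d)

theorem lie_one (x : Lr d r) : ⁅x, one d r⁆ = 0 := (toL d r).injective <| by
  have h := commL_unit_right (toL d r x) 1
  rw [one_smul] at h
  rw [toL_lie, one, LinearEquiv.apply_symm_apply, h, map_zero, map_zero]

theorem one_lie (x : Lr d r) : ⁅one d r, x⁆ = 0 := by
  rw [← lie_skew, lie_one, neg_zero]

theorem v_swap (i j : Fin d) (m n : ℤ) :
    v r i j m n = v r j i n m + heisCoeff i j m n • one d r :=
  (toL d r).injective (Subtype.ext (quad_swap i j m n))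

theorem lie_v (i j k l : Fin d) (m n p q : ℤ) :
    ⁅v r i j m n, v r k l p q⁆ = (toL d r).symm (twist d r (toL d r
      (heisCoeff j k n p • v r i l m q + heisCoeff i k m p • v r j l n q
        + heisCoeff j l n q • v r k i p m + heisCoeff i l m q • v r k j p n))) :=
  (toL d r).injective <| by
    rw [toL_lie, LinearEquiv.apply_symm_apply]
    congr 1
    exact Subtype.ext (quad_comm i j k l m n p q)

/-- The set `B_+` of the `v^{ij}(m, n) ∈ B` with `m ≥ 0` or `n ≥ 0`. -/
def basisPlus (d : ℕ) (r : ℂ) : Set (Lr d r) :=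
  {x | ∃ i j m n, IsNormal i j m n ∧ (0 ≤ m ∨ 0 ≤ n) ∧ x = v r i j m n}

theorem proj₂_v {i j : Fin d} {m n : ℤ} (h : IsNormal i j m n) :
    proj₂ d (toL d r (v r i j m n)) = 0 :=
  proj₂_of_mem_partB (Submodule.subset_span ⟨i, j, m, n, h, rfl⟩)

theorem proj₂_span {x : Lr d r} (hx : x ∈ Submodule.span ℂ (basisPlus d r)) :
    proj₂ d (toL d r x) = 0 := by
  induction hx using Submodule.span_induction with
  | mem x h => obtain ⟨i, j, m, n, h, -, rfl⟩ := h; exact proj₂_v h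
  | zero => simp
  | add x y _ _ h1 h2 => simp [h1, h2]
  | smul a x _ h => simp [h]

theorem twist_span {x : Lr d r} (hx : x ∈ Submodule.span ℂ (basisPlus d r)) :
    (toL d r).symm (twist d r (toL d r x)) = x := by
  rw [twist_eq, proj₂_span hx, mul_zero, zero_smul, add_zero, LinearEquiv.symm_apply_apply]

theorem v_mem_span (i j : Fin d) {m n : ℤ} (hn : 0 ≤ n) :
    v r i j m n ∈ Submodule.span ℂ (basisPlus d r) := by
  by_cases h : IsNormal i j m n
  · exact Submodule.subset_span ⟨i, j, m, n, h, Or.inr hn, rfl⟩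
  · have h' : IsNormal j i n m := by unfold IsNormal at *; omega
    have hc : heisCoeff i j m n = 0 := by
      rw [heisCoeff, if_neg]; unfold IsNormal at h; omega
    rw [v_swap, hc, zero_smul, add_zero]
    exact Submodule.subset_span ⟨j, i, n, m, h', Or.inl hn, rfl⟩

theorem exists_of_mem_basisPlus {x : Lr d r} (hx : x ∈ basisPlus d r) :
    ∃ i j m n, 0 ≤ n ∧ x = v r i j m n := by
  obtain ⟨i, j, m, n, h, hmn, rfl⟩ := hx
  by_cases hn : 0 ≤ n
  · exact ⟨i, j, m, n, hn, rfl⟩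
  · have hc : heisCoeff i j m n = 0 := by
      rw [heisCoeff, if_neg]; unfold IsNormal at h; omega
    exact ⟨j, i, n, m, by omega, by rw [v_swap, hc, zero_smul, add_zero]⟩

theorem lie_mem_span {x y : Lr d r} (hx : x ∈ Submodule.span ℂ (basisPlus d r))
    (hy : y ∈ Submodule.span ℂ (basisPlus d r)) :
    ⁅x, y⁆ ∈ Submodule.span ℂ (basisPlus d r) := by
  induction hx using Submodule.span_induction with
  | zero => simp
  | add x x' _ _ h1 h2 => rw [add_lie]; exact add_mem h1 h2
  | smul a x _ h => rw [smul_lie]; exact Submodule.smul_mem _ _ h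
  | mem x h =>
    induction hy using Submodule.span_induction with
    | zero => simp
    | add x x' _ _ h1 h2 => rw [lie_add]; exact add_mem h1 h2
    | smul a x _ h => rw [lie_smul]; exact Submodule.smul_mem _ _ h
    | mem y h' =>
      obtain ⟨i, j, m, n, hn, rfl⟩ := exists_of_mem_basisPlus h
      obtain ⟨k, l, p, q, hq, rfl⟩ := exists_of_mem_basisPlus h'
      have hc : heisCoeff j l n q = 0 := by
        rw [heisCoeff]
        split_ifs with h0
        · have : n = 0 := by omega
          simp [this]
        · rfl
      have hm : heisCoeff j k n p • v r i l m q + heisCoeff i k m p • v r j l n q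
          + heisCoeff j l n q • v r k i p m + heisCoeff i l m q • v r k j p n
          ∈ Submodule.span ℂ (basisPlus d r) := by
        rw [hc, zero_smul, add_zero]
        exact add_mem (add_mem (Submodule.smul_mem _ _ (v_mem_span _ _ hq))
          (Submodule.smul_mem _ _ (v_mem_span _ _ hq)))
          (Submodule.smul_mem _ _ (v_mem_span _ _ hn))
      rw [lie_v, twist_span hm]
      exact hm

theorem lie_mem_span_of_mem {x y : Lr d r}
    (hx : x ∈ Submodule.span ℂ (basisPlus d r) ⊔ Submodule.span ℂ {one d r})
    (hy : y ∈ Submodule.span ℂ (basisPlus d r) ⊔ Submodule.span ℂ {one d r}) :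
    ⁅x, y⁆ ∈ Submodule.span ℂ (basisPlus d r) := by
  obtain ⟨x, hx', z, hz, rfl⟩ := Submodule.mem_sup.1 hx
  obtain ⟨a, rfl⟩ := Submodule.mem_span_singleton.1 hz
  obtain ⟨y, hy', z, hz', rfl⟩ := Submodule.mem_sup.1 hy
  obtain ⟨b, rfl⟩ := Submodule.mem_span_singleton.1 hz'
  rw [lie_add, lie_smul, lie_one, smul_zero, add_zero, add_lie, smul_lie, one_lie, smul_zero,
    add_zero]
  exact lie_mem_span hx' hy'

/-- The Lie subalgebra `ℒ_r^+ = Span B_+ ⊕ ℂ` of `ℒ_r`. -/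
def plus (d : ℕ) (r : ℂ) : LieSubalgebra ℂ (Lr d r) where
  toSubmodule := Submodule.span ℂ (basisPlus d r) ⊔ Submodule.span ℂ {one d r}
  lie_mem' hx hy := Submodule.mem_sup_left (lie_mem_span_of_mem hx hy)

end Lr

/-- The one-dimensional `ℒ_r^+`-module `ℂ𝟏`, on which `B_+` acts by zero and `s ∈ ℂ ⊂ ℒ_r^+` by `s`. -/
def VacMod (_d : ℕ) (_r : ℂ) : Type := ℂ

namespace VacMod
variable {r : ℂ}

instance : AddCommGroup (VacMod d r) := inferInstanceAs (AddCommGroup ℂ)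
instance : Module ℂ (VacMod d r) := inferInstanceAs (Module ℂ ℂ)

/-- The basis vector `𝟏` of `ℂ𝟏`. -/
def vac (d : ℕ) (r : ℂ) : VacMod d r := (1 : ℂ)

/-- `x ∈ ℒ_r^+` acts by the scalar `π₂(x)`, that is, `0` for `x ∈ Span B_+` and `s` for `x = s ∈ ℂ`;
see `basis_lie` and `one_lie`. -/
instance : Bracket (Lr.plus d r) (VacMod d r) :=
  ⟨fun x z => proj₂ d (Lr.toL d r x) • z⟩

theorem lie_def (x : Lr.plus d r) (z : VacMod d r) : ⁅x, z⁆ = proj₂ d (Lr.toL d r x) • z := rfl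

instance : LieRingModule (Lr.plus d r) (VacMod d r) where
  add_lie x y z := by
    simp only [lie_def]
    rw [← add_smul, ← map_add, ← map_add]
    rfl
  lie_add x y z := by simp only [lie_def, smul_add]
  leibniz_lie x y z := by
    simp only [lie_def, LieSubalgebra.coe_bracket]
    rw [Lr.proj₂_span (Lr.lie_mem_span_of_mem x.2 y.2), zero_smul, zero_add, smul_comm]

instance : LieModule ℂ (Lr.plus d r) (VacMod d r) where
  smul_lie t x z := by
    simp only [lie_def]
    rw [← smul_assoc, ← map_smul, ← map_smul]
    rfl
  lie_smul t x z := by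
    simp only [lie_def]; rw [smul_comm]

theorem basis_lie (x : Lr.plus d r) (hx : (x : Lr d r) ∈ Lr.basisPlus d r) (z : VacMod d r) :
    ⁅x, z⁆ = 0 := by
  rw [lie_def, Lr.proj₂_span (Submodule.subset_span hx), zero_smul]

theorem one_lie (x : Lr.plus d r) (s : ℂ) (hx : (x : Lr d r) = s • Lr.one d r) (z : VacMod d r) :
    ⁅x, z⁆ = s • z := by
  rw [lie_def, hx, map_smul, Lr.one, LinearEquiv.apply_symm_apply, map_smul, proj₂_unitL,
    smul_eq_mul, mul_one]

end VacMod

section Induced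
variable {L : Type*} [LieRing L] [LieAlgebra ℂ L] (K : LieSubalgebra ℂ L)
  (N : Type*) [AddCommGroup N] [Module ℂ N] [LieRingModule K N] [LieModule ℂ K N]

/-- The homomorphism `U(K) → U(L)` induced by the inclusion `K ⊂ L`. -/
def envIncl : UniversalEnvelopingAlgebra ℂ K →ₐ[ℂ] UniversalEnvelopingAlgebra ℂ L :=
  UniversalEnvelopingAlgebra.lift ℂ ((UniversalEnvelopingAlgebra.ι ℂ).comp K.incl)

/-- The action of `U(K)` on a `K`-module `N`. -/
def envAct : UniversalEnvelopingAlgebra ℂ K →ₐ[ℂ] Module.End ℂ N :=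
  UniversalEnvelopingAlgebra.lift ℂ (LieModule.toEnd ℂ K N)

/-- The relations `u a ⊗ z = u ⊗ a z`, `a ∈ U(K)`, that turn `U(L) ⊗_ℂ N` into `U(L) ⊗_{U(K)} N`. -/
def balanced : Submodule (UniversalEnvelopingAlgebra ℂ L) ((UniversalEnvelopingAlgebra ℂ L) ⊗[ℂ] N) :=
  Submodule.span (UniversalEnvelopingAlgebra ℂ L)
    {t | ∃ (u : UniversalEnvelopingAlgebra ℂ L) (a : UniversalEnvelopingAlgebra ℂ K) (z : N), t = (u * envIncl K a) ⊗ₜ[ℂ] z - u ⊗ₜ[ℂ] (envAct K N a z)}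

/-- The induced module `U(L) ⊗_{U(K)} N`, the tensor product over a noncommutative ring, realized as
the quotient of `U(L) ⊗_ℂ N` by the balancing relations. -/
def Induced : Type _ := ((UniversalEnvelopingAlgebra ℂ L) ⊗[ℂ] N) ⧸ balanced K N

namespace Induced

instance : AddCommGroup (Induced K N) := inferInstanceAs (AddCommGroup (_ ⧸ balanced K N))
instance : Module (UniversalEnvelopingAlgebra ℂ L) (Induced K N) := inferInstanceAs (Module (UniversalEnvelopingAlgebra ℂ L) (_ ⧸ balanced K N))
instance : Module ℂ (Induced K N) := inferInstanceAs (Module ℂ (_ ⧸ balanced K N))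
instance : IsScalarTower ℂ (UniversalEnvelopingAlgebra ℂ L) (Induced K N) :=
  inferInstanceAs (IsScalarTower ℂ (UniversalEnvelopingAlgebra ℂ L) (_ ⧸ balanced K N))

/-- The element `u ⊗ z`. -/
def tmul (u : UniversalEnvelopingAlgebra ℂ L) (z : N) : Induced K N := Submodule.Quotient.mk (u ⊗ₜ[ℂ] z)

/-- The action of `x ∈ L` on the induced module. -/
def act (x : L) : Module.End ℂ (Induced K N) :=
  Algebra.lsmul ℂ ℂ (Induced K N) (UniversalEnvelopingAlgebra.ι ℂ x)

variable {K N}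

theorem act_apply (x : L) (w : Induced K N) :
    act K N x w = UniversalEnvelopingAlgebra.ι ℂ x • w := rfl

theorem act_lie (x y : L) (w : Induced K N) :
    act K N x (act K N y w) = act K N ⁅x, y⁆ w + act K N y (act K N x w) := by
  simp only [act_apply, LieHom.map_lie, Ring.lie_def, sub_smul, mul_smul]
  abel

theorem smul_tmul (u u' : UniversalEnvelopingAlgebra ℂ L) (z : N) : u • tmul K N u' z = tmul K N (u * u') z := rfl

theorem tmul_act (x : K) (u : UniversalEnvelopingAlgebra ℂ L) (z : N) :
    tmul K N (u * UniversalEnvelopingAlgebra.ι ℂ (x : L)) z = tmul K N u ⁅x, z⁆ := by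
  refine (Submodule.Quotient.eq _).2 (Submodule.subset_span
    ⟨u, UniversalEnvelopingAlgebra.ι ℂ x, z, ?_⟩)
  rw [envIncl, envAct, UniversalEnvelopingAlgebra.lift_ι_apply,
    UniversalEnvelopingAlgebra.lift_ι_apply]
  rfl

theorem act_tmul_one (x : K) (z : N) : act K N (x : L) (tmul K N 1 z) = tmul K N 1 ⁅x, z⁆ := by
  rw [act_apply, smul_tmul, mul_one, ← tmul_act, one_mul]

theorem adjoin_ι : Algebra.adjoin ℂ (Set.range (UniversalEnvelopingAlgebra.ι ℂ (L := L))) = ⊤ := by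
  let S := Algebra.adjoin ℂ (Set.range (UniversalEnvelopingAlgebra.ι ℂ (L := L)))
  let f : L →ₗ⁅ℂ⁆ S :=
    { toFun := fun x => ⟨UniversalEnvelopingAlgebra.ι ℂ x, Algebra.subset_adjoin ⟨x, rfl⟩⟩
      map_add' := fun x y => Subtype.ext (map_add _ x y)
      map_smul' := fun t x => Subtype.ext (map_smul _ t x)
      map_lie' := fun {x y} => Subtype.ext (LieHom.map_lie _ x y) }
  have h : S.val.comp (UniversalEnvelopingAlgebra.lift ℂ f) = AlgHom.id ℂ _ := by
    refine UniversalEnvelopingAlgebra.hom_ext (R := ℂ) ?_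
    ext x
    change (UniversalEnvelopingAlgebra.lift ℂ f (UniversalEnvelopingAlgebra.ι ℂ x) : UniversalEnvelopingAlgebra ℂ L) = _
    rw [UniversalEnvelopingAlgebra.lift_ι_apply]
    rfl
  refine eq_top_iff.2 fun u _ => ?_
  have := congrArg (fun g => g u) h
  change ((UniversalEnvelopingAlgebra.lift ℂ f u : S) : UniversalEnvelopingAlgebra ℂ L) = u at this
  rw [← this]
  exact (UniversalEnvelopingAlgebra.lift ℂ f u).2

theorem eq_top_of_act {S : Submodule ℂ (Induced K N)} (h1 : ∀ z, tmul K N 1 z ∈ S)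
    (h : ∀ x, ∀ w ∈ S, act K N x w ∈ S) : S = ⊤ := by
  have key : ∀ u : UniversalEnvelopingAlgebra ℂ L, ∀ w ∈ S, u • w ∈ S := by
    intro u
    have hu : u ∈ Algebra.adjoin ℂ (Set.range (UniversalEnvelopingAlgebra.ι ℂ (L := L))) := by
      rw [adjoin_ι]; trivial
    induction hu using Algebra.adjoin_induction with
    | mem x hx => obtain ⟨x, rfl⟩ := hx; exact h x
    | algebraMap t => intro w hw; rw [algebraMap_smul (R := ℂ) (UniversalEnvelopingAlgebra ℂ L)]; exact S.smul_mem _ hw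
    | add x y _ _ hx hy => intro w hw; rw [add_smul]; exact add_mem (hx w hw) (hy w hw)
    | mul x y _ _ hx hy => intro w hw; rw [mul_smul]; exact hx _ (hy w hw)
  refine eq_top_iff.2 fun w _ => ?_
  obtain ⟨t, rfl⟩ := Submodule.Quotient.mk_surjective _ w
  induction t using TensorProduct.induction_on with
  | zero => exact S.zero_mem
  | add x y hx hy => exact S.add_mem (hx trivial) (hy trivial)
  | tmul u z =>
    have := key u _ (h1 z)
    rwa [smul_tmul, mul_one] at this

theorem finite_act {ι : Type*} (f : ι → L) (hf : ∀ x : L, {k | ⁅f k, x⁆ ≠ 0}.Finite)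
    (h1 : ∀ z, {k | act K N (f k) (tmul K N 1 z) ≠ 0}.Finite) (w : Induced K N) :
    {k | act K N (f k) w ≠ 0}.Finite := by
  let S : Submodule ℂ (Induced K N) :=
    { carrier := {w | {k | act K N (f k) w ≠ 0}.Finite}
      add_mem' := fun {x y} hx hy => (Set.Finite.union hx hy).subset fun k hk => by
        by_contra hc
        simp only [Set.mem_union, Set.mem_ofPred_eq, not_or, not_not] at hc
        exact hk (by rw [map_add, hc.1, hc.2, add_zero])
      zero_mem' := by simp
      smul_mem' := fun a x hx => Set.Finite.subset hx fun k hk hc => hk (by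
        rw [map_smul, hc, smul_zero]) }
  have hS : S = ⊤ := eq_top_of_act h1 fun x w hw =>
    (Set.Finite.union (hf x) hw).subset fun k hk => by
      by_contra hc
      simp only [Set.mem_union, Set.mem_ofPred_eq, not_or, not_not] at hc
      exact hk (by rw [act_lie, hc.1, hc.2]; simp [act_apply])
  have : w ∈ S := by rw [hS]; trivial
  exact this

end Induced
end Induced

/-- The sum of a locally finite family of operators: each vector is killed by all but finitely many
of the `T k`, so the sum of the `T k w` is finite. -/
def opSum {ι M : Type*} [AddCommGroup M] [Module ℂ M] (T : ι → Module.End ℂ M)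
    (hT : ∀ w, {k | T k w ≠ 0}.Finite) : Module.End ℂ M where
  toFun w := ∑ᶠ k, T k w
  map_add' x y := by
    simp only [map_add]
    exact finsum_add_distrib (hT x) (hT y)
  map_smul' a x := by
    simp only [map_smul, RingHom.id_apply]
    exact (smul_finsum' a (hT x)).symm

/-- `M_r = U(ℒ_r) ⊗_{U(ℒ_r^+)} ℂ𝟏`. -/
abbrev Mr (d : ℕ) (r : ℂ) : Type := Induced (Lr.plus d r) (VacMod d r)

namespace Mr
variable {r : ℂ}

/-- The vacuum `𝟏 = 1 ⊗ 𝟏 ∈ M_r`. -/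
def vac (d : ℕ) (r : ℂ) : Mr d r := Induced.tmul _ _ 1 (VacMod.vac d r)

variable (r) in
/-- The action of `v^{ij}(m, n) ∈ ℒ_r` on `M_r`. -/
def v (i j : Fin d) (m n : ℤ) : Module.End ℂ (Mr d r) := Induced.act _ _ (Lr.v r i j m n)

theorem act_tmul_eq_zero (i j : Fin d) {m n : ℤ} (hn : 0 ≤ n) (z : VacMod d r) :
    v r i j m n (Induced.tmul _ _ 1 z) = 0 := by
  have h := Lr.v_mem_span (r := r) i j (m := m) hn
  have h' := Induced.act_tmul_one (K := Lr.plus d r) ⟨_, Submodule.mem_sup_left h⟩ z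
  refine h'.trans ?_
  rw [VacMod.lie_def, Lr.proj₂_span h, zero_smul, Induced.tmul, TensorProduct.tmul_zero]
  rfl

theorem finite_lie_v (i j : Fin d) (m : ℤ) (x : Lr d r) :
    {h : ℤ | ⁅Lr.v r i j (m - h) h, x⁆ ≠ 0}.Finite := by
  have hx : ((Lr.toL d r x : calL d) : Weyl d) ∈ calL d := (Lr.toL d r x).2
  suffices H : {h : ℤ | quad i j (m - h) h * (Lr.toL d r x : Weyl d)
      - (Lr.toL d r x : Weyl d) * quad i j (m - h) h ≠ 0}.Finite by
    refine H.subset fun h hh hc => hh ((Lr.toL d r).injective ?_)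
    have : commL (Lr.toL d r (Lr.v r i j (m - h) h)) (Lr.toL d r x) = 0 := Subtype.ext hc
    rw [Lr.toL_lie, this, map_zero, map_zero]
  refine calL_induction (P := fun y => {h : ℤ | quad i j (m - h) h * y
      - y * quad i j (m - h) h ≠ 0}.Finite) ?_ ?_ ?_ ?_ hx
  · intro k l p q
    refine (Set.toFinite ({-p, -q, m + p, m + q} : Set ℤ)).subset fun h hh => ?_
    by_contra hc
    simp only [Set.mem_insert_iff, Set.mem_singleton_iff, not_or] at hc
    refine hh ?_
    rw [quad_comm, heisCoeff, heisCoeff, heisCoeff, heisCoeff, if_neg (by omega), if_neg (by omega), if_neg (by omega),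
      if_neg (by omega)]
    simp
  · simp
  · intro y z hy hz
    refine (hy.union hz).subset fun h hh => ?_
    by_contra hc
    simp only [Set.mem_union, Set.mem_ofPred_eq, not_or, not_not] at hc
    exact hh (by rw [mul_add, add_mul, add_sub_add_comm, hc.1, hc.2, add_zero])
  · intro a y hy
    refine hy.subset fun h hh hc => hh ?_
    rw [smul_mul_assoc, mul_smul_comm, ← smul_sub, hc, smul_zero]

theorem finite_v {i j : Fin d} {m : ℤ} (hm : ¬ (i = j ∧ m = 0)) (w : Mr d r) :
    {h : ℤ | v r i j (m - h) h w ≠ 0}.Finite := by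
  refine Induced.finite_act (fun h : ℤ => Lr.v r i j (m - h) h) (finite_lie_v i j m)
    (fun z => ?_) w
  refine (Set.finite_Icc m 0).subset fun h hh => ?_
  by_contra hc
  rw [Set.mem_Icc, not_and_or, not_le, not_le] at hc
  refine hh ?_
  rcases hc with hc | hc
  · have h0 : heisCoeff i j (m - h) h = 0 := by rw [heisCoeff, if_neg]; omega
    rw [Lr.v_swap, h0, zero_smul, add_zero]
    exact act_tmul_eq_zero j i (by omega) z
  · exact act_tmul_eq_zero i j hc.le z

theorem finite_v_zero (i : Fin d) (w : Mr d r) :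
    {h : {h : ℤ // 0 < h} | v r i i (-h) h w ≠ 0}.Finite := by
  refine Induced.finite_act (fun h : {h : ℤ // 0 < h} => Lr.v r i i (-h) h) (fun x => ?_)
    (fun z => ?_) w
  · have h := finite_lie_v (r := r) i i 0 x
    simp only [zero_sub] at h
    exact h.preimage Subtype.val_injective.injOn
  · refine Set.finite_empty.subset fun h hh => hh ?_
    exact act_tmul_eq_zero i i h.2.le z

variable (r) in
/-- The operator `L_r^{ij}(m)` on `M_r`: it is `½ v^{ii}(0,0) + ∑_{h>0} v^{ii}(-h,h)` if `i = j` and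
`m = 0`, and `½ ∑_{h ∈ ℤ} v^{ij}(m-h,h)` otherwise. -/
def vir (i j : Fin d) (m : ℤ) : Module.End ℂ (Mr d r) :=
  if hm : i = j ∧ m = 0 then
    (1 / 2 : ℂ) • v r i i 0 0
      + opSum (fun h : {h : ℤ // 0 < h} => v r i i (-h) h) (finite_v_zero i)
  else
    (1 / 2 : ℂ) • opSum (fun h : ℤ => v r i j (m - h) h) (finite_v hm)

/-- `L_r^{i₁j₁}(m₁) ⋯ L_r^{i_pj_p}(m_p) 𝟏` for the word `[(i₁,j₁,m₁), …, (i_p,j_p,m_p)]`, `p ≥ 0`. -/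
def virWord (r : ℂ) (l : List (Fin d × Fin d × ℤ)) : Mr d r :=
  (l.map fun a => vir r a.1 a.2.1 a.2.2).prod (vac d r)

/-- The subspace `V_𝒥` of `M_r` spanned by all `L_r^{i₁j₁}(m₁) ⋯ L_r^{i_pj_p}(m_p) 𝟏`. -/
def VJ (d : ℕ) (r : ℂ) : Submodule ℂ (Mr d r) :=
  Submodule.span ℂ (Set.range (virWord (d := d) r))

end Mr

end VJordan

end

namespace VJordan

/-! Let `W` be the span of the words in the `L^{ij}(m)` with `m ∈ {-2, -1, 0}`. These operators
stabilize `W`, and the operators stabilizing `W` form an algebra. It suffices that this algebra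
contains every `v^{ij}(-p, -q)` with `p, q ≥ 1`, since these generate `M_r` from the vacuum
(`eq_top_of_neg`). The individual summands come from an eigenvalue separation. For `i ≠ j`,
`v^{ij}(a, b)` is an eigenvector of `ad L^{ii}(0)` with eigenvalue `-a` (`vir_zero_v`), so the
summands of `L^{ij}(m)` have distinct eigenvalues. On a given vector only finitely many summands act
nontrivially, and a polynomial in the eigenvalues isolates any one of them
(`mem_stabilizer_of_opSum_mem`). Thus `v^{ij}(m-h, h)` stabilizes `W` for all `h` and `m ∈ {-2, -1,
0}`. The rest is obtained from two commutators with `i ≠ j`: `[v^{ij}(-p, p), v^{ji}(-p, -q)] = p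
v^{ii}(-p, -q)`, `[v^{ij}(-p-1, p), v^{jj}(-p, -q)] = p v^{ij}(-p-1, -q)`, with `2p` for `p` if `p =
q`. Together they raise `p` by one, starting from `v^{ij}(-1, -1)`, a summand of `L^{ij}(-2)`. No
commutator used has a double contraction, so `r` never enters. -/

/-- The operators that map the subspace `W` into itself. -/
def stabilizer {M : Type*} [AddCommGroup M] [Module ℂ M] (W : Submodule ℂ M) :
    Subalgebra ℂ (Module.End ℂ M) where
  carrier := {T | ∀ w ∈ W, T w ∈ W}
  mul_mem' hS hT w hw := hS _ (hT w hw)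
  add_mem' hS hT w hw := add_mem (hS w hw) (hT w hw)
  algebraMap_mem' a _ hw := W.smul_mem a hw

/-! ### Separating the terms of a locally finite sum by eigenvalues -/

section LocallyFinite
open Polynomial
variable {ι M : Type*} [AddCommGroup M] [Module ℂ M] {W : Submodule ℂ M}
  {T : ι → Module.End ℂ M} {H : Module.End ℂ M} {c : ι → ℂ}

theorem finite_smul (hT : ∀ w, {k | T k w ≠ 0}.Finite) (a : ι → ℂ) (w : M) :
    {k | a k • T k w ≠ 0}.Finite :=
  (hT w).subset fun _ hk hc => hk (by rw [hc, smul_zero])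

/-- Commuting `H` past the sum weighted by `c k ^ n` produces the sum weighted by `c k ^ (n + 1)`
plus the old sum at `H w`. The induction therefore runs over all `w ∈ W` at once. -/
theorem finsum_pow_smul_mem (hT : ∀ w, {k | T k w ≠ 0}.Finite)
    (hsum : opSum T hT ∈ stabilizer W) (hH : H ∈ stabilizer W)
    (hc : ∀ k w, H (T k w) = c k • T k w + T k (H w)) (n : ℕ) :
    ∀ w ∈ W, ∑ᶠ k, c k ^ n • T k w ∈ W := by
  induction n with
  | zero =>
    intro w hw
    simp only [pow_zero, one_smul]
    exact hsum w hw
  | succ n ih =>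
    intro w hw
    have h1 : H (∑ᶠ k, c k ^ n • T k w)
        = ∑ᶠ k, c k ^ (n + 1) • T k w + ∑ᶠ k, c k ^ n • T k (H w) := by
      rw [← finsum_add_distrib (finite_smul hT _ w) (finite_smul hT _ (H w)),
        map_finsum H (finite_smul hT _ w)]
      refine finsum_congr fun k => ?_
      rw [map_smul, hc, smul_add, smul_smul, pow_succ]
    rw [eq_sub_iff_add_eq.2 h1.symm]
    exact sub_mem (hH _ (ih w hw)) (ih _ (hH w hw))

theorem finsum_eval_smul_mem (hT : ∀ w, {k | T k w ≠ 0}.Finite)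
    (hsum : opSum T hT ∈ stabilizer W) (hH : H ∈ stabilizer W)
    (hc : ∀ k w, H (T k w) = c k • T k w + T k (H w)) (P : ℂ[X]) {w : M} (hw : w ∈ W) :
    ∑ᶠ k, P.eval (c k) • T k w ∈ W := by
  induction P using Polynomial.induction_on' with
  | add P Q hP hQ =>
    simp only [eval_add, add_smul]
    rw [finsum_add_distrib (finite_smul hT _ w) (finite_smul hT _ w)]
    exact add_mem hP hQ
  | monomial n a =>
    simp only [eval_monomial, mul_smul]
    rw [← smul_finsum' a (finite_smul hT _ w)]
    exact W.smul_mem a (finsum_pow_smul_mem hT hsum hH hc n w hw)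

/-- If the sum of a locally finite family of eigenvectors of `ad H` with distinct eigenvalues
stabilizes `W`, and so does `H`, then each member of the family stabilizes `W`. -/
theorem mem_stabilizer_of_opSum_mem (hT : ∀ w, {k | T k w ≠ 0}.Finite)
    (hsum : opSum T hT ∈ stabilizer W) (hH : H ∈ stabilizer W)
    (hc : ∀ k w, H (T k w) = c k • T k w + T k (H w)) (hinj : Function.Injective c) (k : ι) :
    T k ∈ stabilizer W := by
  classical
  intro w hw
  -- `P` vanishes at `c l` for every `l ≠ k` with `T l w ≠ 0`, but not at `c k`; the weighted sum
  -- collapses to `P(c k) • T k w`. The polynomial depends on `w`.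
  set P : ℂ[X] := ∏ l ∈ (hT w).toFinset.erase k, (X - C (c l))
  have hP : P.eval (c k) ≠ 0 := by
    rw [eval_prod, Finset.prod_ne_zero_iff]
    intro l hl
    rw [eval_sub, eval_X, eval_C, sub_ne_zero]
    exact fun h => Finset.ne_of_mem_erase hl (hinj h).symm
  have h := finsum_eval_smul_mem hT hsum hH hc P hw
  rw [finsum_eq_single _ k] at h
  · exact (W.smul_mem_iff hP).1 h
  · intro l hl
    by_cases h0 : T l w = 0
    · rw [h0, smul_zero]
    · have hmem : l ∈ (hT w).toFinset.erase k :=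
        Finset.mem_erase.2 ⟨hl, (hT w).mem_toFinset.2 h0⟩
      rw [eval_prod, Finset.prod_eq_zero hmem (by simp), zero_smul]

end LocallyFinite

variable {d : ℕ} {r : ℂ}

/-! ### Commutators of quadratic elements without central term -/

theorem heisCoeff_of_ne {i j : Fin d} (h : i ≠ j) (m n : ℤ) : heisCoeff i j m n = 0 :=
  if_neg fun h' => h h'.2

theorem heisCoeff_of_add_ne (i j : Fin d) {m n : ℤ} (h : m + n ≠ 0) : heisCoeff i j m n = 0 :=
  if_neg fun h' => h h'.1

theorem heisCoeff_swap (i j : Fin d) (m n : ℤ) : heisCoeff i j m n = -heisCoeff j i n m := by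
  unfold heisCoeff
  by_cases h : m + n = 0 ∧ i = j
  · obtain ⟨h, rfl⟩ := h
    obtain rfl : m = -n := by omega
    simp
  · rw [if_neg h, if_neg (fun h' => h ⟨by omega, h'.2.symm⟩), neg_zero]

/-- When the two factors commute, restoring normal order costs no scalar, so the element already
lies in `Span B`. -/
theorem Lr.proj₂_v_of_heisCoeff {i j : Fin d} {m n : ℤ} (h : heisCoeff i j m n = 0) :
    proj₂ d (toL d r (v r i j m n)) = 0 := by
  by_cases hn : IsNormal i j m n
  · exact proj₂_v hn
  · have hn' : IsNormal j i n m := by unfold IsNormal at *; omega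
    rw [v_swap, h, zero_smul, add_zero]
    exact proj₂_v hn'

/-- A commutator of two quadratic elements without a central term. -/
theorem Lr.lie_v_of_mul_eq_zero {i j k l : Fin d} {m n p q : ℤ}
    (h1 : heisCoeff j k n p * heisCoeff i l m q = 0)
    (h2 : heisCoeff i k m p * heisCoeff j l n q = 0) :
    ⁅v r i j m n, v r k l p q⁆ =
      heisCoeff j k n p • v r i l m q + heisCoeff i k m p • v r j l n q
        + heisCoeff j l n q • v r k i p m + heisCoeff i l m q • v r k j p n := by
  have key : ∀ {a : ℂ} {i j : Fin d} {m n : ℤ}, a * heisCoeff i j m n = 0 →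
      a * proj₂ d (toL d r (v r i j m n)) = 0 := fun {a i j m n} h => by
    rcases mul_eq_zero.1 h with h | h
    · rw [h, zero_mul]
    · rw [proj₂_v_of_heisCoeff h, mul_zero]
  rw [lie_v, twist_eq]
  simp only [map_add, map_smul, smul_eq_mul]
  -- Each of the four terms has `π₂` equal, up to sign, to one of the two products of contractions
  -- in `h1` and `h2`; hence the twist by `r` is invisible.
  rw [key h1, key h2,
    key (show heisCoeff j l n q * heisCoeff k i p m = 0 by
      rw [heisCoeff_swap k i, mul_neg, mul_comm, h2, neg_zero]),
    key (show heisCoeff i l m q * heisCoeff k j p n = 0 by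
      rw [heisCoeff_swap k j, mul_neg, mul_comm, h1, neg_zero])]
  simp

namespace Mr

theorem v_swap {i j : Fin d} {m n : ℤ} (h : heisCoeff i j m n = 0) :
    v r i j m n = v r j i n m := by
  rw [v, Lr.v_swap, h, zero_smul, add_zero, v]

theorem v_comm {i j k l : Fin d} {m n p q : ℤ}
    (h1 : heisCoeff j k n p * heisCoeff i l m q = 0)
    (h2 : heisCoeff i k m p * heisCoeff j l n q = 0) (w : Mr d r) :
    v r i j m n (v r k l p q w) =
      heisCoeff j k n p • v r i l m q w + heisCoeff i k m p • v r j l n q w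
        + heisCoeff j l n q • v r k i p m w + heisCoeff i l m q • v r k j p n w
        + v r k l p q (v r i j m n w) := by
  have hact : ∀ (x y : Lr d r), Induced.act (Lr.plus d r) (VacMod d r) (x + y) w
      = Induced.act _ _ x w + Induced.act _ _ y w := fun x y => by
    simp only [Induced.act_apply, map_add, add_smul]
  have hsmul : ∀ (a : ℂ) (x : Lr d r), Induced.act (Lr.plus d r) (VacMod d r) (a • x) w
      = a • Induced.act _ _ x w := fun a x => by
    simp only [Induced.act_apply, map_smul, smul_assoc]
  simp only [v]
  rw [Induced.act_lie, Lr.lie_v_of_mul_eq_zero h1 h2]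
  simp only [hact, hsmul]

/-! ### The adjoint action of `L^{ii}(0)` -/

/-- The commutator of `v^{ii}(-k, k)` with `v^{ij}(a, b)`. -/
theorem v_diag_comm {i j : Fin d} (hij : i ≠ j) (k a b : ℤ) (w : Mr d r) :
    v r i i (-k) k (v r i j a b w) =
      (heisCoeff i i k a + heisCoeff i i (-k) a) • v r i j a b w
        + v r i j a b (v r i i (-k) k w) := by
  rw [v_comm (by rw [heisCoeff_of_ne hij, mul_zero]) (by rw [heisCoeff_of_ne hij, mul_zero]),
    heisCoeff_of_ne hij, heisCoeff_of_ne hij, zero_smul, zero_smul, add_zero, add_zero, add_smul]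
  -- A nonzero coefficient forces `a = -k` in the first term and `a = k` in the second, so both
  -- quadratic elements are `v^{ij}(a, b)` itself.
  congr 2
  · by_cases h : k + a = 0
    · obtain rfl : a = -k := by omega
      rfl
    · rw [heisCoeff_of_add_ne _ _ h, zero_smul, zero_smul]
  · by_cases h : -k + a = 0
    · obtain rfl : a = k := by omega
      rfl
    · rw [heisCoeff_of_add_ne _ _ h, zero_smul, zero_smul]

/-- Only `h = |a|` contributes: the first coefficient if `a < 0`, the second if `a > 0`, neither if
`a = 0`. The value is `-a` in every case. -/
theorem finsum_heisCoeff (i : Fin d) (a : ℤ) (x : Mr d r) :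
    ∑ᶠ h : {h : ℤ // 0 < h}, (heisCoeff i i h a + heisCoeff i i (-h) a) • x = (-a : ℂ) • x := by
  rcases lt_trichotomy a 0 with ha | rfl | ha
  · rw [finsum_eq_single _ (⟨-a, by omega⟩ : {h : ℤ // 0 < h})]
    · congr 1
      rw [heisCoeff_of_add_ne i i (show - -a + a ≠ 0 by omega)]
      simp [heisCoeff]
    · rintro ⟨h, hh⟩ hne
      rw [heisCoeff_of_add_ne, heisCoeff_of_add_ne, add_zero, zero_smul]
      · change -h + a ≠ 0; omega
      · have : h ≠ -a := fun e => hne (Subtype.ext e)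
        change h + a ≠ 0; omega
  · rw [finsum_eq_zero_of_forall_eq_zero]
    · simp
    · rintro ⟨h, hh⟩
      rw [heisCoeff_of_add_ne, heisCoeff_of_add_ne, add_zero, zero_smul]
      · change -h + 0 ≠ 0; omega
      · change h + 0 ≠ 0; omega
  · rw [finsum_eq_single _ (⟨a, ha⟩ : {h : ℤ // 0 < h})]
    · congr 1
      rw [heisCoeff_of_add_ne i i (show a + a ≠ 0 by omega)]
      simp [heisCoeff]
    · rintro ⟨h, hh⟩ hne
      rw [heisCoeff_of_add_ne, heisCoeff_of_add_ne, add_zero, zero_smul]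
      · have : h ≠ a := fun e => hne (Subtype.ext e)
        change -h + a ≠ 0; omega
      · change h + a ≠ 0; omega

/-- `v^{ij}(a, b)` with `i ≠ j` is an eigenvector of `ad L^{ii}(0)` with eigenvalue `-a`. -/
theorem vir_zero_v {i j : Fin d} (hij : i ≠ j) (a b : ℤ) (w : Mr d r) :
    vir r i i 0 (v r i j a b w) = (-a : ℂ) • v r i j a b w + v r i j a b (vir r i i 0 w) := by
  have h0 : v r i i 0 0 (v r i j a b w) = v r i j a b (v r i i 0 0 w) := by
    have h := v_diag_comm hij 0 a b w
    have hz : heisCoeff i i 0 a = 0 := by simp [heisCoeff]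
    rwa [neg_zero, hz, add_zero, zero_smul, zero_add] at h
  have h1 : ∑ᶠ h : {h : ℤ // 0 < h}, v r i i (-h) h (v r i j a b w)
      = (-a : ℂ) • v r i j a b w
        + v r i j a b (∑ᶠ h : {h : ℤ // 0 < h}, v r i i (-h) h w) := by
    rw [map_finsum _ (finite_v_zero i w), ← finsum_heisCoeff i a (v r i j a b w),
      ← finsum_add_distrib]
    · exact finsum_congr fun h => v_diag_comm hij h a b w
    -- Splitting the sum requires finite support of the scalar part; it is contained in `{a, -a}`.
    · refine Set.Finite.subset (s := {h : {h : ℤ // 0 < h} | h.1 ∈ ({a, -a} : Set ℤ)})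
        ((Set.toFinite _).preimage Subtype.val_injective.injOn) fun h hh => ?_
      by_contra hc
      simp only [Set.mem_ofPred_eq, Set.mem_insert_iff, Set.mem_singleton_iff, not_or] at hc
      refine hh ?_
      beta_reduce
      rw [heisCoeff_of_add_ne, heisCoeff_of_add_ne, add_zero, zero_smul] <;> omega
    · refine (finite_v_zero i w).subset fun h hh hc => hh ?_
      beta_reduce
      rw [hc, map_zero]
  have hv : ∀ w : Mr d r, vir r i i 0 w = (1 / 2 : ℂ) • v r i i 0 0 w
      + ∑ᶠ h : {h : ℤ // 0 < h}, v r i i (-h) h w := fun w => by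
    rw [vir, dif_pos ⟨rfl, rfl⟩]; rfl
  rw [hv, hv, h0, h1, map_add, map_smul]
  abel

/-! ### Quadratic operators that stabilize `W` -/

section Stabilizer
variable {W : Submodule ℂ (Mr d r)}

/-- The eigenvalue `-(m - h)` determines `h`, so the separation result applies with `H = L^{ii}(0)`.
-/
theorem v_mem_stabilizer_of_vir {i j : Fin d} (hij : i ≠ j) {m : ℤ}
    (h0 : vir r i i 0 ∈ stabilizer W) (hm : vir r i j m ∈ stabilizer W) (h : ℤ) :
    v r i j (m - h) h ∈ stabilizer W := by
  have hne : ¬ (i = j ∧ m = 0) := fun h => hij h.1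
  have hsum : opSum (fun h : ℤ => v r i j (m - h) h) (finite_v hne) ∈ stabilizer W := by
    rw [vir, dif_neg hne] at hm
    -- Multiplication by `2` cancels the factor `1/2` in the definition of `L^{ij}(m)`.
    simpa [smul_smul] using (stabilizer W).smul_mem hm (2 : ℂ)
  refine mem_stabilizer_of_opSum_mem (c := fun h : ℤ => (-(m - h : ℤ) : ℂ))
    (finite_v hne) hsum h0 (fun k w => vir_zero_v hij _ _ w) (fun a b hab => ?_) h
  have hab' : ((m - a : ℤ) : ℂ) = ((m - b : ℤ) : ℂ) := neg_injective hab
  have := Int.cast_injective (α := ℂ) hab'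
  omega

theorem mem_stabilizer_of_comm {S T U : Module.End ℂ (Mr d r)} {a : ℂ} (ha : a ≠ 0)
    (hS : S ∈ stabilizer W) (hT : T ∈ stabilizer W)
    (h : ∀ w, S (T w) = a • U w + T (S w)) : U ∈ stabilizer W := fun w hw => by
  refine (W.smul_mem_iff ha).1 ?_
  rw [eq_sub_iff_add_eq.2 (h w).symm]
  exact sub_mem (hS _ (hT w hw)) (hT _ (hS w hw))

/-- The inner pair `v^j(p)`, `v^j(-p)` is the only contraction in the commutator of the two given
operators, and it contributes the nonzero factor `p`. -/
theorem v_diag_mem_stabilizer {i j : Fin d} (hij : i ≠ j) {p q : ℤ} (hp : 0 < p) (hq : 0 < q)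
    (h0 : v r i j (-p) p ∈ stabilizer W) (h : v r j i (-p) (-q) ∈ stabilizer W) :
    v r i i (-p) (-q) ∈ stabilizer W := by
  refine mem_stabilizer_of_comm (a := (p : ℂ)) (by exact_mod_cast hp.ne') h0 h fun w => ?_
  have hz : heisCoeff i i (-p) (-q) = 0 := heisCoeff_of_add_ne _ _ (by omega)
  rw [v_comm (by rw [hz, mul_zero]) (by rw [heisCoeff_of_ne hij, zero_mul]), hz,
    heisCoeff_of_ne hij, heisCoeff_of_ne hij.symm]
  simp [heisCoeff]

/-- Contracting `v^j(p)` with `v^j(-p)` replaces the first mode `-p` by `-(p + 1)`; this is the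
inductive step in `p`. -/
theorem v_succ_mem_stabilizer {i j : Fin d} (hij : i ≠ j) {p q : ℤ} (hp : 0 < p)
    (h1 : v r i j (-(p + 1)) p ∈ stabilizer W) (h : v r j j (-p) (-q) ∈ stabilizer W) :
    v r i j (-(p + 1)) (-q) ∈ stabilizer W := by
  have hp' : (p : ℂ) ≠ 0 := by exact_mod_cast hp.ne'
  -- For `p = q` the mode `v^j(p)` contracts with both factors of `v^{jj}(-p, -p)`. The two results
  -- agree after a swap, which doubles the coefficient.
  by_cases hpq : p = q
  · subst hpq
    refine mem_stabilizer_of_comm (a := 2 * (p : ℂ)) (mul_ne_zero two_ne_zero hp') h1 h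
      fun w => ?_
    rw [v_comm (by rw [heisCoeff_of_ne hij, mul_zero]) (by rw [heisCoeff_of_ne hij, zero_mul]),
      heisCoeff_of_ne hij,
      v_swap (heisCoeff_of_ne hij.symm (-p) (-(p + 1)))]
    have : heisCoeff j j p (-p) = p := by simp [heisCoeff]
    rw [this, zero_smul, zero_smul, two_mul, add_smul, add_zero, add_zero]
  · refine mem_stabilizer_of_comm (a := (p : ℂ)) hp' h1 h fun w => ?_
    rw [v_comm (by rw [heisCoeff_of_ne hij, mul_zero]) (by rw [heisCoeff_of_ne hij, zero_mul]),
      heisCoeff_of_ne hij, heisCoeff_of_ne hij,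
      heisCoeff_of_add_ne j j (show p + -q ≠ 0 by omega)]
    simp [heisCoeff]

theorem v_mem_stabilizer_of_ne
    (hW : ∀ i j : Fin d, ∀ m : ℤ, m = -2 ∨ m = -1 ∨ m = 0 → vir r i j m ∈ stabilizer W)
    {p q : ℤ} (hp : 1 ≤ p) (hq : 1 ≤ q) :
    ∀ i j : Fin d, i ≠ j → v r i j (-p) (-q) ∈ stabilizer W := by
  -- One step goes `v^{ij}(-p, -q)` to `v^{jj}(-p, -q)` to `v^{ij}(-(p+1), -q)`, using the summands
  -- `v^{ji}(-p, p)` of `L^{ji}(0)` and `v^{ij}(-1-p, p)` of `L^{ij}(-1)`.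
  have hs : ∀ p q : ℤ, 1 ≤ p → 1 ≤ q → (∀ i j : Fin d, i ≠ j → v r i j (-p) (-q) ∈ stabilizer W) →
      ∀ i j : Fin d, i ≠ j → v r i j (-(p + 1)) (-q) ∈ stabilizer W := by
    intro p q hp hq h i j hij
    have h0 := v_mem_stabilizer_of_vir hij.symm (hW j j 0 (by simp)) (hW j i 0 (by simp)) p
    have h1 := v_mem_stabilizer_of_vir hij (hW i i 0 (by simp)) (hW i j (-1) (by simp)) p
    rw [zero_sub] at h0
    rw [show -1 - p = -(p + 1) by ring] at h1
    exact v_succ_mem_stabilizer hij (by omega) h1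
      (v_diag_mem_stabilizer hij.symm (by omega) (by omega) h0 (h i j hij))
  have h11 : ∀ i j : Fin d, i ≠ j → v r i j (-1) (-1) ∈ stabilizer W := fun i j hij => by
    have h := v_mem_stabilizer_of_vir hij (hW i i 0 (by simp)) (hW i j (-2) (by simp)) (-1)
    rwa [show (-2 : ℤ) - -1 = -1 by norm_num] at h
  have hp1 : ∀ p : ℤ, 1 ≤ p → ∀ i j : Fin d, i ≠ j → v r i j (-p) (-1) ∈ stabilizer W :=
    fun p hp => Int.leInduction h11 (fun p hp ih => hs p 1 hp le_rfl ih) p hp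
  -- The step raises only the first mode. The case `(1, q)` is the swap of `(q, 1)`, which `hp1`
  -- supplies; from there `p` is raised with `q` fixed.
  refine Int.leInduction (motive := fun p _ => ∀ i j : Fin d, i ≠ j →
    v r i j (-p) (-q) ∈ stabilizer W) ?_ (fun p hp ih => hs p q hp hq ih) p hp
  intro i j hij
  rw [v_swap (heisCoeff_of_ne hij _ _)]
  exact hp1 q hq j i hij.symm

theorem v_mem_stabilizer
    (hW : ∀ i j : Fin d, ∀ m : ℤ, m = -2 ∨ m = -1 ∨ m = 0 → vir r i j m ∈ stabilizer W)
    (hd : 2 ≤ d) (i j : Fin d) {p q : ℤ} (hp : 1 ≤ p) (hq : 1 ≤ q) :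
    v r i j (-p) (-q) ∈ stabilizer W := by
  by_cases hij : i = j
  · subst hij
    -- The diagonal case needs an auxiliary index `k ≠ i`; this is where `2 ≤ d` enters.
    have : Nontrivial (Fin d) := Fin.nontrivial_iff_two_le.2 hd
    obtain ⟨k, hk⟩ := exists_ne i
    have h0 := v_mem_stabilizer_of_vir hk.symm (hW i i 0 (by simp)) (hW i k 0 (by simp)) p
    rw [zero_sub] at h0
    exact v_diag_mem_stabilizer hk.symm (by omega) (by omega) h0
      (v_mem_stabilizer_of_ne hW hp hq k i hk)
  · exact v_mem_stabilizer_of_ne hW hp hq i j hij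

end Stabilizer

/-! ### Generation of `M_r` by the negative modes -/

theorem act_one_vac : Induced.act (Lr.plus d r) (VacMod d r) (Lr.one d r) (vac d r) = vac d r := by
  have hmem : Lr.one d r ∈ Lr.plus d r :=
    Submodule.mem_sup_right (Submodule.mem_span_singleton_self _)
  have h := Induced.act_tmul_one (K := Lr.plus d r) ⟨_, hmem⟩ (VacMod.vac d r)
  rw [VacMod.one_lie _ 1 (one_smul ℂ (Lr.one d r)).symm, one_smul] at h
  exact h

theorem act_vac_mem {W : Submodule ℂ (Mr d r)} (hvac : vac d r ∈ W)
    (hneg : ∀ i j : Fin d, ∀ m n : ℤ, m < 0 → n < 0 → v r i j m n ∈ stabilizer W) (x : Lr d r) :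
    Induced.act (Lr.plus d r) (VacMod d r) x (vac d r) ∈ W := by
  let f : Lr d r →ₗ[ℂ] Mr d r :=
    { toFun := fun x => Induced.act (Lr.plus d r) (VacMod d r) x (vac d r)
      map_add' := fun x y => by simp only [Induced.act_apply, map_add, add_smul]
      map_smul' := fun a x => by
        simp only [Induced.act_apply, map_smul, smul_assoc, RingHom.id_apply] }
  have hone : f (Lr.one d r) ∈ W := by
    change Induced.act _ _ _ _ ∈ W
    rw [act_one_vac]; exact hvac
  have hv : ∀ i j m n, f (Lr.v r i j m n) ∈ W := by
    have hvn : ∀ i j : Fin d, ∀ m n : ℤ, m < 0 ∨ 0 ≤ n → f (Lr.v r i j m n) ∈ W := by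
      intro i j m n h
      change v r i j m n (vac d r) ∈ W
      by_cases hn : 0 ≤ n
      · rw [show v r i j m n (vac d r) = 0 from act_tmul_eq_zero i j hn _]
        exact W.zero_mem
      · exact hneg i j m n (by omega) (by omega) _ hvac
    intro i j m n
    by_cases h : m < 0 ∨ 0 ≤ n
    · exact hvn i j m n h
    -- Here `m ≥ 0` and `n < 0`: after the swap the nonnegative mode stands on the right and kills
    -- the vacuum, leaving a multiple of the vacuum.
    · rw [Lr.v_swap, map_add, map_smul]
      exact add_mem (hvn j i n m (by omega)) (W.smul_mem _ hone)
  have H : ∀ (y : Weyl d) (_ : y ∈ calL d), ∀ hy : y ∈ calL d, f ((Lr.toL d r).symm ⟨y, hy⟩) ∈ W := by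
    intro y hy0
    refine (calL_induction (P := fun y => ∃ hy : y ∈ calL d,
      f ((Lr.toL d r).symm ⟨y, hy⟩) ∈ W) ?_ ?_ ?_ ?_ hy0).elim fun _ h _ => h
    · exact fun i j m n => ⟨quad_mem_calL i j m n, hv i j m n⟩
    · exact ⟨one_mem_calL, hone⟩
    · rintro x y ⟨hx, h⟩ ⟨hy, h'⟩
      refine ⟨add_mem hx hy, ?_⟩
      have := add_mem h h'
      rwa [← map_add, ← map_add] at this
    · rintro a x ⟨hx, h⟩
      refine ⟨Submodule.smul_mem _ a hx, ?_⟩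
      have := W.smul_mem a h
      rwa [← map_smul, ← map_smul] at this
  exact H _ (Lr.toL d r x).2 (Lr.toL d r x).2

/-- `M_r` is generated from the vacuum by the operators `v^{ij}(m, n)` with `m, n < 0`. -/
theorem eq_top_of_neg {W : Submodule ℂ (Mr d r)} (hvac : vac d r ∈ W)
    (hneg : ∀ i j : Fin d, ∀ m n : ℤ, m < 0 → n < 0 → v r i j m n ∈ stabilizer W) : W = ⊤ := by
  -- Passing to the smallest subspace `sInf F` with the two properties allows an argument by
  -- minimality, with no need for a PBW basis.
  let F : Set (Submodule ℂ (Mr d r)) := {S | vac d r ∈ S ∧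
    ∀ i j : Fin d, ∀ m n : ℤ, m < 0 → n < 0 → v r i j m n ∈ stabilizer S}
  have hF : sInf F ∈ F := by
    refine ⟨Submodule.mem_sInf.2 fun S hS => hS.1, fun i j m n hm hn w hw => ?_⟩
    exact Submodule.mem_sInf.2 fun S hS => hS.2 i j m n hm hn w (Submodule.mem_sInf.1 hw S hS)
  -- `S` consists of the vectors of `sInf F` that all of `ℒ_r` sends into `sInf F`. Once `S ∈ F`,
  -- minimality gives `sInf F ≤ S`, so `sInf F` is an `ℒ_r`-submodule.
  let S : Submodule ℂ (Mr d r) :=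
    { carrier := {w | w ∈ sInf F ∧ ∀ x, Induced.act (Lr.plus d r) (VacMod d r) x w ∈ sInf F}
      add_mem' := fun {w w'} h h' => ⟨add_mem h.1 h'.1, fun x => by
        rw [map_add]; exact add_mem (h.2 x) (h'.2 x)⟩
      zero_mem' := ⟨zero_mem _, fun x => by rw [map_zero]; exact zero_mem _⟩
      smul_mem' := fun a w h => ⟨Submodule.smul_mem _ a h.1, fun x => by
        rw [map_smul]; exact Submodule.smul_mem _ a (h.2 x)⟩ }
  have hS : S ∈ F := by
    refine ⟨⟨hF.1, act_vac_mem hF.1 hF.2⟩, fun i j m n hm hn w hw => ?_⟩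
    refine ⟨hF.2 i j m n hm hn w hw.1, fun x => ?_⟩
    rw [v, Induced.act_lie]
    -- In `x v w = [x, v] w + v x w`, the bracket is again an element of `ℒ_r`, so the first term is
    -- covered by `w ∈ S`.
    exact add_mem (hw.2 _) (hF.2 i j m n hm hn _ (hw.2 x))
  have htop : sInf F = ⊤ := by
    refine Induced.eq_top_of_act (fun z => ?_) fun x w hw => ((sInf_le hS : sInf F ≤ S) hw).2 x
    have : Induced.tmul (Lr.plus d r) (VacMod d r) 1 z = (show ℂ from z) • vac d r := by
      have hz : z = (show ℂ from z) • VacMod.vac d r := (mul_one (show ℂ from z)).symm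
      conv_lhs => rw [hz, Induced.tmul, TensorProduct.tmul_smul]
      rfl
    rw [this]
    exact Submodule.smul_mem _ _ hF.1
  exact eq_top_iff.2 (htop ▸ sInf_le (show W ∈ F from ⟨hvac, hneg⟩))

/-! ### The words with modes in `{-2, -1, 0}` -/

theorem span_virWord_eq_top (hd : 2 ≤ d) (r : ℂ) :
    Submodule.span ℂ {w : Mr d r | ∃ l : List (Fin d × Fin d × ℤ),
      (∀ a ∈ l, a.2.2 = -2 ∨ a.2.2 = -1 ∨ a.2.2 = 0) ∧ w = virWord r l} = ⊤ := by
  refine eq_top_of_neg (Submodule.subset_span ⟨[], by simp, by simp [virWord]⟩)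
    fun i j m n hm hn => ?_
  have h := v_mem_stabilizer (W := Submodule.span ℂ {w : Mr d r | ∃ l : List (Fin d × Fin d × ℤ),
      (∀ a ∈ l, a.2.2 = -2 ∨ a.2.2 = -1 ∨ a.2.2 = 0) ∧ w = virWord r l}) ?_ hd i j
    (p := -m) (q := -n) (by omega) (by omega)
  · rwa [neg_neg, neg_neg] at h
  intro i j m hm w hw
  induction hw using Submodule.span_induction with
  | zero => rw [map_zero]; exact zero_mem _
  | add x y _ _ hx hy => rw [map_add]; exact add_mem hx hy
  | smul a x _ hx => rw [map_smul]; exact Submodule.smul_mem _ _ hx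
  | mem w hw =>
    obtain ⟨l, hl, rfl⟩ := hw
    -- Applying `L^{ij}(m)` to a word prepends a letter, which is why these operators stabilize the
    -- span.
    refine Submodule.subset_span ⟨(i, j, m) :: l, ?_, ?_⟩
    · intro a ha
      rcases List.mem_cons.1 ha with rfl | ha
      · exact hm
      · exact hl a ha
    · simp [virWord]

end Mr

end VJordan

theorem proposition3p1 (d : ℕ) (hd : 2 ≤ d) (r : ℂ) :
    VJordan.Mr.VJ d r = ⊤ ∧
      Submodule.span ℂ {w : VJordan.Mr d r | ∃ l : List (Fin d × Fin d × ℤ),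
        (∀ a ∈ l, a.2.2 = -2 ∨ a.2.2 = -1 ∨ a.2.2 = 0) ∧ w = VJordan.Mr.virWord r l} = ⊤ := by
  refine ⟨eq_top_iff.2 ?_, VJordan.Mr.span_virWord_eq_top hd r⟩
  rw [← VJordan.Mr.span_virWord_eq_top hd r]
  refine Submodule.span_mono ?_
  rintro _ ⟨l, -, rfl⟩
  exact ⟨l, rfl⟩
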